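/- There is an absolute constant $C>0$ such that the following holds. Let $(Q_2(u),\,u\ge 0)$ be a Bessel process of dimension $2$ started at $0$, that is, a process with almost surely continuous paths that has the law of the Euclidean norm of a standard two-dimensional Brownian motion started at $0$. Let $a,k:(0,\infty)\to(0,\infty)$ be functions with $a(t)\to+\infty$ and $k(t)\to+\infty$ as $t\to+\infty$. Then, for all sufficiently large $t$, $$P\Big(\forall u\in(0,k(t)],\ Q_2^2(u)\le 2e\big[a(t)+4\log\log(e\,k(t)/u)\big]\,u\Big)\ \ge\ 1-C\,e^{-a(t)/2}.$$ -/

import Mathlib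

open MeasureTheory ProbabilityTheory Filter
open scoped NNReal

/-- The law of `(‖B s‖)_{s ∈ I}`, where `B = (B₁, …, B_d)` is a standard `d`-dimensional Brownian
motion started at `0` and `‖·‖` is the Euclidean norm: the coordinates `B_j` are independent, and
each `(B_j s)_{s ∈ I}` is a centered Gaussian vector with covariance `min s t`. -/
noncomputable def besselLaw (d : ℕ) (I : Finset ℝ≥0) : Measure (I → ℝ) :=
  (Measure.pi fun _ : Fin d ↦ BrownianReal.projectiveFamily I).map
    fun x s ↦ √(∑ j, x j s ^ 2)

/-- `Q` is a Bessel process of (integer) dimension `d` started at `0` under `P`: it has almost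
surely continuous paths and its finite-dimensional distributions are those of the Euclidean norm of
a `d`-dimensional standard Brownian motion started at `0`. -/
structure IsBesselProcess {Ω : Type*} [MeasurableSpace Ω] (d : ℕ) (Q : ℝ≥0 → Ω → ℝ)
    (P : Measure Ω) : Prop where
  hasLaw : ∀ I : Finset ℝ≥0, HasLaw (fun ω ↦ I.restrict (Q · ω)) (besselLaw d I) P
  cont : ∀ᵐ ω ∂P, Continuous (Q · ω)

/-! Cut `(0, k]` at the geometric times `T n = k * exp (-n)`. On `(T (n+1), T n]` the envelope is at
least `2 * l n * T n` with `l n = a + 4 * log (n + 1)`: the factor `e` pays for replacing `u` by `T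
n`. Hence a violation forces `Q ^ 2` to exceed `2 * l n * T n` before `T n`, for some `n`. By
`measure_exists_sq_gt_le` this has probability at most `8 * exp (-l n / 2) = 8 * exp (-a / 2) / (n +
1) ^ 2`, which is summable in `n`.

The tail bound reduces to the two Brownian coordinates, where Lévy's inequality (by reflection) and
a Gaussian tail apply at finitely many times; path continuity then gives all times. -/

/-- Reflection of a path `x` at time `t`: the path is unchanged up to time `t`, and all its
increments after `t` change sign. -/
def pathReflection {ι : Type*} [LinearOrder ι] (t : ι) (x : ι → ℝ) (s : ι) : ℝ :=
  2 * x (min s t) - x s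

lemma pathReflection_of_le {ι : Type*} [LinearOrder ι] {s t : ι} (h : s ≤ t) (x : ι → ℝ) :
    pathReflection t x s = x s := by
  rw [pathReflection, min_eq_left h]; ring

lemma pathReflection_of_ge {ι : Type*} [LinearOrder ι] {s t : ι} (h : t ≤ s) (x : ι → ℝ) :
    pathReflection t x s = 2 * x t - x s := by
  rw [pathReflection, min_eq_right h]

/-- Two Gaussian measures on `ι → ℝ` with the same coordinate means and covariances are equal. -/
lemma isGaussian_pi_ext {ι : Type*} [Fintype ι] {μ ν : Measure (ι → ℝ)} [IsGaussian μ]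
    [IsGaussian ν] (hm : ∀ i, ∫ x, x i ∂μ = ∫ x, x i ∂ν)
    (hc : ∀ i j, cov[fun x ↦ x i, fun x ↦ x j; μ] = cov[fun x ↦ x i, fun x ↦ x j; ν]) :
    μ = ν := by
  have hint (ρ : Measure (ι → ℝ)) [IsGaussian ρ] (i : ι) : Integrable (fun x ↦ x i) ρ :=
    (IsGaussian.hasGaussianLaw_id.eval i).integrable
  -- Move to Euclidean space, where the covariance is a bilinear form on the space itself.
  apply (MeasurableEquiv.toLp 2 (ι → ℝ)).map_measurableEquiv_injective
  rw [MeasurableEquiv.coe_toLp, ← PiLp.coe_symm_continuousLinearEquiv 2 ℝ]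
  apply IsGaussian.ext
  · rw [integral_map (by fun_prop) (by fun_prop), integral_map (by fun_prop) (by fun_prop)]
    simp only [id_eq]
    rw [ContinuousLinearEquiv.integral_comp_id_comm, ContinuousLinearEquiv.integral_comp_id_comm]
    congr 1
    ext i
    rw [eval_integral (hint μ), eval_integral (hint ν)]
    exact hm i
  · rw [← ContinuousLinearMap.toBilinForm_inj]
    refine LinearMap.BilinForm.ext_of_isSymm isPosSemidef_covarianceBilin.isSymm
      isPosSemidef_covarianceBilin.isSymm fun x ↦ ?_
    simp only [ContinuousLinearMap.toBilinForm_apply]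
    rw [PiLp.coe_symm_continuousLinearEquiv, covarianceBilin_apply_pi, covarianceBilin_apply_pi]
    · exact Finset.sum_congr rfl fun i _ ↦ Finset.sum_congr rfl fun j _ ↦ by rw [hc i j]
    · exact fun i ↦ (IsGaussian.hasGaussianLaw_id.eval i).memLp_two
    · exact fun i ↦ (IsGaussian.hasGaussianLaw_id.eval i).memLp_two

/-- The finite-dimensional laws of Brownian motion are invariant under reflection. -/
lemma measurePreserving_pathReflection (I : Finset ℝ≥0) (t : I) :
    MeasurePreserving (pathReflection t) (BrownianReal.projectiveFamily I)
      (BrownianReal.projectiveFamily I) := by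
  let L : (I → ℝ) →L[ℝ] (I → ℝ) := ContinuousLinearMap.pi fun s ↦
    (2 : ℝ) • ContinuousLinearMap.proj (R := ℝ) (φ := fun _ : I ↦ ℝ) (min s t) -
      ContinuousLinearMap.proj (R := ℝ) (φ := fun _ : I ↦ ℝ) s
  have hL : pathReflection t = ⇑L := by
    ext x s
    simp [L, pathReflection]
  have hmeas : Measurable (pathReflection t) := by rw [hL]; fun_prop
  have heval (i : I) : MemLp (fun x : I → ℝ ↦ x i) 2 (BrownianReal.projectiveFamily I) :=
    (IsGaussian.hasGaussianLaw_id.eval i).memLp_two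
  have hint (i : I) : Integrable (fun x : I → ℝ ↦ x i) (BrownianReal.projectiveFamily I) :=
    (heval i).integrable one_le_two
  have hG : IsGaussian ((BrownianReal.projectiveFamily I).map (pathReflection t)) := by
    rw [hL]; infer_instance
  refine ⟨hmeas, isGaussian_pi_ext (fun i ↦ ?_) (fun i j ↦ ?_)⟩
  · rw [integral_map hmeas.aemeasurable (measurable_pi_apply i).aestronglyMeasurable]
    simp only [pathReflection]
    rw [integral_sub ((hint _).const_mul 2) (hint _), integral_const_mul]
    simp
  · rw [covariance_map_fun (measurable_pi_apply i).aestronglyMeasurable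
      (measurable_pi_apply j).aestronglyMeasurable hmeas.aemeasurable]
    simp only [pathReflection]
    have hdiff : MemLp (fun x : I → ℝ ↦ 2 * x (min j t) - x j) 2
        (BrownianReal.projectiveFamily I) := ((heval _).const_mul 2).sub (heval _)
    rw [covariance_fun_sub_left ((heval _).const_mul 2) (heval _) hdiff,
      covariance_fun_sub_right ((heval _).const_mul 2) ((heval _).const_mul 2) (heval _),
      covariance_fun_sub_right (heval _) ((heval _).const_mul 2) (heval _)]
    simp only [covariance_const_mul_left, covariance_const_mul_right,
      BrownianReal.covariance_eval_projectiveFamily]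
    have hmin (a : I) : ((min a t : I) : ℝ≥0) = min a.1 t.1 :=
      (Subtype.mono_coe (· ∈ I)).map_min
    simp only [hmin]
    -- All mixed covariances equal the same `m`, so the reflected covariance is `4m - 2m - 2m` plus
    -- the original one.
    have h1 : min (min i.1 t.1) (min j.1 t.1) = min (min i.1 j.1) t.1 := by grind
    have h2 : min (min i.1 t.1) j.1 = min (min i.1 j.1) t.1 := by grind
    have h3 : min i.1 (min j.1 t.1) = min (min i.1 j.1) t.1 := by grind
    rw [h1, h2, h3]
    ring

/-- **Lévy's maximal inequality** for Brownian motion at finitely many times. -/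
lemma projectiveFamily_exists_abs_ge_le (I : Finset ℝ≥0) (T : I) (hT : ∀ s : I, s ≤ T) (r : ℝ) :
    BrownianReal.projectiveFamily I {x | ∃ s, r ≤ |x s|} ≤
      2 * BrownianReal.projectiveFamily I {x | r ≤ |x T|} := by
  set μ := BrownianReal.projectiveFamily I
  set D : Set (I → ℝ) := {x | r ≤ |x T|}
  -- `s` is the first time that level `r` is reached.
  let A (s : I) : Set (I → ℝ) := {x | r ≤ |x s| ∧ ∀ s' < s, |x s'| < r}
  have hD : MeasurableSet D := measurableSet_le (by fun_prop) (by fun_prop)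
  have hA (s : I) : MeasurableSet (A s) := by
    have h : A s = {x | r ≤ |x s|} ∩ ⋂ s' : I, ⋂ _ : s' < s, {x | |x s'| < r} := by
      ext x; simp [A]
    rw [h]
    refine (measurableSet_le (by fun_prop) (by fun_prop)).inter
      (MeasurableSet.iInter fun s' ↦ MeasurableSet.iInter fun _ ↦ ?_)
    exact measurableSet_lt (by fun_prop) (by fun_prop)
  have hcover : {x | ∃ s, r ≤ |x s|} ⊆ ⋃ s, A s := by
    rintro x ⟨s, hs⟩
    obtain ⟨m, hm, hmin⟩ := (Finset.univ.filter fun s : I ↦ r ≤ |x s|).exists_minimal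
      ⟨s, by simpa using hs⟩
    simp only [Finset.mem_filter, Finset.mem_univ, true_and] at hm hmin
    refine Set.mem_iUnion.2 ⟨m, hm, fun s' hs' ↦ ?_⟩
    by_contra! h
    exact (hmin h hs'.le).not_gt hs'
  have hdisj : Pairwise (Function.onFun Disjoint fun s ↦ A s ∩ D) := by
    intro s s' hne
    refine Set.disjoint_left.2 fun x hx hx' ↦ ?_
    rcases lt_or_gt_of_ne hne with h | h
    · exact (hx'.1.2 s h).not_ge hx.1.1
    · exact (hx.1.2 s' h).not_ge hx'.1.1
  have hstep (s : I) : μ (A s) ≤ 2 * μ (A s ∩ D) := by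
    have hR := measurePreserving_pathReflection I s
    -- If `|x T| < r ≤ |x s|`, the reflected endpoint satisfies `|2 * x s - x T| ≥ 2r - r`.
    have hsub : A s ⊆ (A s ∩ D) ∪ pathReflection s ⁻¹' (A s ∩ D) := by
      intro x hx
      by_cases hxD : x ∈ D
      · exact Or.inl ⟨hx, hxD⟩
      · refine Or.inr ⟨⟨?_, fun s' hs' ↦ ?_⟩, ?_⟩
        · rw [pathReflection_of_le le_rfl]; exact hx.1
        · rw [pathReflection_of_le hs'.le]; exact hx.2 s' hs'
        · have h1 : |x T| < r := not_le.1 hxD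
          have h2 := hx.1
          simp only [D, Set.mem_ofPred_eq, pathReflection_of_ge (hT s)]
          have h3 := abs_sub_abs_le_abs_sub (2 * x s) (x T)
          rw [abs_mul, abs_two] at h3
          linarith
    calc μ (A s) ≤ μ (A s ∩ D) + μ (pathReflection s ⁻¹' (A s ∩ D)) :=
          (measure_mono hsub).trans (measure_union_le _ _)
      _ = 2 * μ (A s ∩ D) := by
          rw [hR.measure_preimage ((hA s).inter hD).nullMeasurableSet, two_mul]
  calc μ {x | ∃ s, r ≤ |x s|} ≤ ∑ s, μ (A s) :=
        (measure_mono hcover).trans (measure_iUnion_fintype_le _ _)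
    _ ≤ ∑ s, 2 * μ (A s ∩ D) := Finset.sum_le_sum fun s _ ↦ hstep s
    _ = 2 * μ (⋃ s, A s ∩ D) := by
        rw [← Finset.mul_sum, measure_iUnion hdisj fun s ↦ (hA s).inter hD, tsum_fintype]
    _ ≤ 2 * μ D := by
        gcongr
        exact Set.iUnion_subset fun s ↦ Set.inter_subset_right

lemma gaussianReal_ge_le {v : ℝ≥0} (hv : 0 < v) {r : ℝ} (hr : 0 ≤ r) :
    (gaussianReal 0 v).real {x | r ≤ x} ≤ Real.exp (-(r ^ 2 / (2 * v))) := by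
  have hv' : (0 : ℝ) < v := hv
  -- Chernoff bound at the optimal exponent `r / v`.
  refine (measure_ge_le_exp_mul_mgf (X := id) (t := r / v) r (by positivity)
    (integrable_exp_mul_gaussianReal _)).trans_eq ?_
  rw [mgf_id_gaussianReal, ← Real.exp_add]
  congr 1
  field_simp
  ring

lemma gaussianReal_abs_ge_le {v : ℝ≥0} (hv : 0 < v) {r : ℝ} (hr : 0 ≤ r) :
    (gaussianReal 0 v) {x | r ≤ |x|} ≤ ENNReal.ofReal (2 * Real.exp (-(r ^ 2 / (2 * v)))) := by
  have h1 := gaussianReal_ge_le hv hr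
  have hneg : (gaussianReal 0 v) {x | r ≤ -x} = (gaussianReal 0 v) {x | r ≤ x} := by
    conv_rhs => rw [← neg_zero, ← gaussianReal_map_neg]
    rw [Measure.map_apply (by fun_prop) (measurableSet_le (by fun_prop) (by fun_prop))]
    rfl
  have hle : (gaussianReal 0 v) {x | r ≤ x} ≤ ENNReal.ofReal (Real.exp (-(r ^ 2 / (2 * v)))) := by
    rw [← ofReal_measureReal]
    exact ENNReal.ofReal_le_ofReal h1
  have hsub : {x : ℝ | r ≤ |x|} ⊆ {x | r ≤ x} ∪ {x | r ≤ -x} := by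
    intro x hx
    simpa [le_abs] using hx
  calc (gaussianReal 0 v) {x | r ≤ |x|}
      ≤ (gaussianReal 0 v) {x | r ≤ x} + (gaussianReal 0 v) {x | r ≤ -x} :=
        (measure_mono hsub).trans (measure_union_le _ _)
    _ = 2 * (gaussianReal 0 v) {x | r ≤ x} := by rw [hneg, two_mul]
    _ ≤ 2 * ENNReal.ofReal (Real.exp (-(r ^ 2 / (2 * v)))) := by gcongr
    _ = ENNReal.ofReal (2 * Real.exp (-(r ^ 2 / (2 * v)))) := by
        rw [ENNReal.ofReal_mul zero_le_two, ENNReal.ofReal_ofNat]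

/-- Gaussian tail of the running maximum of Brownian motion at finitely many times. -/
lemma projectiveFamily_exists_abs_ge_le_exp (I : Finset ℝ≥0) (T : I) (hT : ∀ s : I, s ≤ T)
    (hT0 : 0 < T.1) {r : ℝ} (hr : 0 ≤ r) :
    BrownianReal.projectiveFamily I {x | ∃ s, r ≤ |x s|} ≤
      ENNReal.ofReal (4 * Real.exp (-(r ^ 2 / (2 * T.1)))) := by
  have h := (BrownianReal.measurePreserving_eval_projectiveFamily T).measure_preimage
    (s := {y : ℝ | r ≤ |y|}) (measurableSet_le (by fun_prop) (by fun_prop)).nullMeasurableSet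
  calc BrownianReal.projectiveFamily I {x | ∃ s, r ≤ |x s|}
      ≤ 2 * BrownianReal.projectiveFamily I {x | r ≤ |x T|} :=
        projectiveFamily_exists_abs_ge_le I T hT r
    _ = 2 * gaussianReal 0 T {x | r ≤ |x|} := by rw [← h]; rfl
    _ ≤ 2 * ENNReal.ofReal (2 * Real.exp (-(r ^ 2 / (2 * T.1)))) := by
        gcongr
        exact gaussianReal_abs_ge_le hT0 hr
    _ = ENNReal.ofReal (4 * Real.exp (-(r ^ 2 / (2 * T.1)))) := by
        rw [← ENNReal.ofReal_ofNat, ← ENNReal.ofReal_mul (by norm_num)]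
        congr 1
        ring

/-- If the sum of two squares exceeds `2lT`, one of them is at least `lT`; a union bound over the
coordinates doubles the constant 4. -/
lemma besselLaw_two_exists_sq_gt_le (I : Finset ℝ≥0) (T : I) (hT : ∀ s : I, s ≤ T)
    (hT0 : 0 < T.1) {l : ℝ} (hl : 0 ≤ l) :
    besselLaw 2 I {y | ∃ s, 2 * l * T.1 < y s ^ 2} ≤
      ENNReal.ofReal (8 * Real.exp (-(l / 2))) := by
  have hT0' : (0 : ℝ) < T.1 := hT0
  set r := √(l * T.1)
  have hr2 : r ^ 2 = l * T.1 := Real.sq_sqrt (by positivity)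
  have hmeas : MeasurableSet {y : I → ℝ | ∃ s, 2 * l * T.1 < y s ^ 2} := by
    simp only [Set.ofPred_exists]
    exact MeasurableSet.iUnion fun s ↦ measurableSet_lt (by fun_prop) (by fun_prop)
  have hE : MeasurableSet {x : I → ℝ | ∃ s, r ≤ |x s|} := by
    simp only [Set.ofPred_exists]
    exact MeasurableSet.iUnion fun s ↦ measurableSet_le (by fun_prop) (by fun_prop)
  rw [besselLaw, Measure.map_apply (by fun_prop) hmeas]
  set ν := Measure.pi fun _ : Fin 2 ↦ BrownianReal.projectiveFamily I
  have hsub : (fun (x : Fin 2 → I → ℝ) s ↦ √(∑ j, x j s ^ 2)) ⁻¹'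
      {y : I → ℝ | ∃ s, 2 * l * T.1 < y s ^ 2} ⊆
      ⋃ j, Function.eval j ⁻¹' {x : I → ℝ | ∃ s, r ≤ |x s|} := by
    rintro x ⟨s, hs⟩
    rw [Real.sq_sqrt (by positivity), Fin.sum_univ_two] at hs
    simp only [Set.mem_iUnion, Set.mem_preimage, Set.mem_ofPred_eq, Function.eval]
    by_contra! h
    have key (j : Fin 2) : x j s ^ 2 < l * T.1 := by
      rw [← hr2, ← sq_abs]
      exact pow_lt_pow_left₀ (h j s) (abs_nonneg _) two_ne_zero
    linarith [key 0, key 1]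
  have hb (j : Fin 2) : ν (Function.eval j ⁻¹' {x : I → ℝ | ∃ s, r ≤ |x s|}) ≤
      ENNReal.ofReal (4 * Real.exp (-(l / 2))) := by
    rw [(measurePreserving_eval (fun _ : Fin 2 ↦ BrownianReal.projectiveFamily I)
      j).measure_preimage hE.nullMeasurableSet]
    refine (projectiveFamily_exists_abs_ge_le_exp I T hT hT0 (Real.sqrt_nonneg _)).trans_eq ?_
    rw [hr2]
    congr 4
    field_simp
  calc ν _ ≤ ∑ j, ν (Function.eval j ⁻¹' {x : I → ℝ | ∃ s, r ≤ |x s|}) :=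
        (measure_mono hsub).trans (measure_iUnion_fintype_le _ _)
    _ ≤ ∑ _j : Fin 2, ENNReal.ofReal (4 * Real.exp (-(l / 2))) :=
        Finset.sum_le_sum fun j _ ↦ hb j
    _ = ENNReal.ofReal (8 * Real.exp (-(l / 2))) := by
        rw [Fin.sum_univ_two, ← ENNReal.ofReal_add (by positivity) (by positivity)]
        congr 1
        ring

lemma summable_one_div_nat_add_one_sq : Summable fun n : ℕ ↦ 1 / ((n : ℝ) + 1) ^ 2 := by
  simpa using (summable_nat_add_iff 1).2 (Real.summable_one_div_nat_pow.2 one_lt_two)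

namespace IsBesselProcess

variable {Ω : Type*} [MeasurableSpace Ω] {P : Measure Ω} {Q : ℝ≥0 → Ω → ℝ}

lemma measure_finset_exists_sq_gt_le (hQ : IsBesselProcess 2 Q P) (I : Finset ℝ≥0) {T : ℝ≥0}
    (hTI : T ∈ I) (hT : ∀ s ∈ I, s ≤ T) (hT0 : 0 < T) {l : ℝ} (hl : 0 ≤ l) :
    P {ω | ∃ s ∈ I, 2 * l * T < Q s ω ^ 2} ≤ ENNReal.ofReal (8 * Real.exp (-(l / 2))) := by
  have hmeas : MeasurableSet {y : I → ℝ | ∃ s, 2 * l * T < y s ^ 2} := by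
    simp only [Set.ofPred_exists]
    exact MeasurableSet.iUnion fun s ↦ measurableSet_lt (by fun_prop) (by fun_prop)
  have h := besselLaw_two_exists_sq_gt_le I ⟨T, hTI⟩ (fun s ↦ hT s s.2) hT0 hl
  rw [← (hQ.hasLaw I).map_eq, Measure.map_apply_of_aemeasurable (hQ.hasLaw I).aemeasurable hmeas]
    at h
  refine le_trans (measure_mono ?_) h
  rintro ω ⟨s, hs, hlt⟩
  exact ⟨⟨s, hs⟩, hlt⟩

/-- Tail bound for the running maximum of a two-dimensional Bessel process. -/
lemma measure_exists_sq_gt_le (hQ : IsBesselProcess 2 Q P) {T : ℝ≥0} (hT0 : 0 < T) {l : ℝ}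
    (hl : 0 ≤ l) :
    P {ω | ∃ u ≤ T, 2 * l * T < Q u ω ^ 2} ≤ ENNReal.ofReal (8 * Real.exp (-(l / 2))) := by
  -- Dense times clipped at `T`, with `T` added so that it is the maximum of each finite set.
  let I (N : ℕ) : Finset ℝ≥0 :=
    insert T ((Finset.range N).image fun n ↦ min (TopologicalSpace.denseSeq ℝ≥0 n) T)
  have hI : Monotone I := fun M N h ↦
    Finset.insert_subset_insert _ (Finset.image_subset_image (Finset.range_mono h))
  have hmono : Monotone fun N ↦ {ω | ∃ s ∈ I N, 2 * l * T < Q s ω ^ 2} :=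
    fun M N h ω ⟨s, hs, hlt⟩ ↦ ⟨s, hI h hs, hlt⟩
  have hae : {ω | ∃ u ≤ T, 2 * l * T < Q u ω ^ 2} ≤ᵐ[P]
      ⋃ N, {ω | ∃ s ∈ I N, 2 * l * T < Q s ω ^ 2} := by
    filter_upwards [hQ.cont] with ω hω
    rintro ⟨u, hu, hlt⟩
    have hopen : IsOpen {v : ℝ≥0 | 2 * l * T < Q (min v T) ω ^ 2} :=
      isOpen_lt (by fun_prop) (by fun_prop)
    obtain ⟨n, hn⟩ := (TopologicalSpace.denseRange_denseSeq ℝ≥0).exists_mem_open hopen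
      ⟨u, by simpa [min_eq_left hu] using hlt⟩
    exact Set.mem_iUnion.2 ⟨n + 1, _, Finset.mem_insert_of_mem
      (Finset.mem_image.2 ⟨n, Finset.self_mem_range_succ n, rfl⟩), hn⟩
  refine (measure_mono_ae hae).trans ?_
  rw [hmono.measure_iUnion]
  refine iSup_le fun N ↦ hQ.measure_finset_exists_sq_gt_le (I N) (Finset.mem_insert_self _ _)
    (fun s hs ↦ ?_) hT0 hl
  rcases Finset.mem_insert.1 hs with rfl | hs
  · exact le_rfl
  · obtain ⟨n, -, rfl⟩ := Finset.mem_image.1 hs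
    exact min_le_right _ _

lemma measure_exists_envelope_lt_le (hQ : IsBesselProcess 2 Q P) {a k : ℝ} (ha : 0 < a)
    (hk : 0 < k) :
    P {ω | ∃ u : ℝ≥0, 0 < u ∧ (u : ℝ) ≤ k ∧
        2 * Real.exp 1 * (a + 4 * Real.log (Real.log (Real.exp 1 * k / u))) * u < Q u ω ^ 2} ≤
      ENNReal.ofReal ((8 * ∑' n : ℕ, 1 / ((n : ℝ) + 1) ^ 2) * Real.exp (-a / 2)) := by
  let T (n : ℕ) : ℝ≥0 := ⟨k * Real.exp (-n), by positivity⟩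
  have hT (n : ℕ) : (T n : ℝ) = k * Real.exp (-n) := rfl
  have hT0 (n : ℕ) : 0 < T n := NNReal.coe_pos.1 (by rw [hT]; positivity)
  let l (n : ℕ) : ℝ := a + 4 * Real.log (n + 1)
  have hlog (n : ℕ) : 0 ≤ Real.log ((n : ℝ) + 1) := Real.log_nonneg (by simp)
  have hl (n : ℕ) : 0 ≤ l n := by linarith [hlog n]
  have hexp (n : ℕ) :
      8 * Real.exp (-(l n / 2)) = 8 * Real.exp (-a / 2) * (1 / ((n : ℝ) + 1) ^ 2) := by
    have h : -(l n / 2) = -a / 2 + -(Real.log (n + 1) + Real.log (n + 1)) := by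
      simp only [l]; ring
    rw [h, Real.exp_add, Real.exp_neg, Real.exp_add, Real.exp_log (by positivity)]
    ring
  have hsum := summable_one_div_nat_add_one_sq
  have hsub : {ω | ∃ u : ℝ≥0, 0 < u ∧ (u : ℝ) ≤ k ∧
      2 * Real.exp 1 * (a + 4 * Real.log (Real.log (Real.exp 1 * k / u))) * u < Q u ω ^ 2} ⊆
      ⋃ n, {ω | ∃ u ≤ T n, 2 * l n * T n < Q u ω ^ 2} := by
    rintro ω ⟨u, hu, huk, hlt⟩
    have hu' : (0 : ℝ) < u := hu
    have h0 : 0 ≤ Real.log (k / u) := Real.log_nonneg ((one_le_div hu').2 huk)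
    -- This is the `n` with `T (n+1) < u ≤ T n`; moreover `log (e * k / u) = 1 + log (k / u) ≥ n +
    -- 1`.
    set n := ⌊Real.log (k / u)⌋₊
    have hn : (n : ℝ) ≤ Real.log (k / u) := Nat.floor_le h0
    have hn' : Real.log (k / u) < n + 1 := Nat.lt_floor_add_one _
    have hku : k = u * Real.exp (Real.log (k / u)) := by
      rw [Real.exp_log (by positivity)]; field_simp
    have huT : (u : ℝ) ≤ T n := by
      rw [hT, hku, mul_assoc, ← Real.exp_add]
      exact le_mul_of_one_le_right hu'.le (Real.one_le_exp (by linarith))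
    have hTu : (T n : ℝ) ≤ Real.exp 1 * u := by
      rw [hT, hku, mul_assoc, ← Real.exp_add, mul_comm (Real.exp 1)]
      gcongr
      linarith
    have hll : Real.log (n + 1) ≤ Real.log (Real.log (Real.exp 1 * k / u)) := by
      rw [mul_div_assoc, Real.log_mul (Real.exp_ne_zero _) (by positivity), Real.log_exp]
      exact Real.log_le_log (by positivity) (by linarith)
    refine Set.mem_iUnion.2 ⟨n, u, huT, lt_of_le_of_lt ?_ hlt⟩
    calc 2 * l n * T n ≤ 2 * l n * (Real.exp 1 * u) := by
          gcongr
          linarith [hl n]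
      _ = 2 * Real.exp 1 * l n * u := by ring
      _ ≤ _ := by gcongr; simp only [l]; linarith
  calc P _ ≤ ∑' n, P {ω | ∃ u ≤ T n, 2 * l n * T n < Q u ω ^ 2} :=
        (measure_mono hsub).trans (measure_iUnion_le _)
    _ ≤ ∑' n : ℕ, ENNReal.ofReal (8 * Real.exp (-a / 2) * (1 / ((n : ℝ) + 1) ^ 2)) := by
        refine ENNReal.tsum_le_tsum fun n ↦ ?_
        rw [← hexp]
        exact hQ.measure_exists_sq_gt_le (hT0 n) (hl n)
    _ = _ := by
        rw [← ENNReal.ofReal_tsum_of_nonneg (fun n ↦ by positivity) (hsum.mul_left _),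
          tsum_mul_left]
        congr 1
        ring

end IsBesselProcess

theorem lemma7p5 :
    ∃ C : ℝ, 0 < C ∧
      ∀ {Ω : Type*} [MeasurableSpace Ω] (P : Measure Ω) [IsProbabilityMeasure P]
        (Q : ℝ≥0 → Ω → ℝ), IsBesselProcess 2 Q P →
      ∀ a k : ℝ → ℝ, (∀ t, 0 < t → 0 < a t) → (∀ t, 0 < t → 0 < k t) →
        Tendsto a atTop atTop → Tendsto k atTop atTop →
      ∀ᶠ t in atTop,
        1 - C * Real.exp (-(a t) / 2) ≤
          P.real {ω | ∀ u : ℝ≥0, 0 < u → (u : ℝ) ≤ k t →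
            Q u ω ^ 2 ≤
              2 * Real.exp 1 * (a t + 4 * Real.log (Real.log (Real.exp 1 * k t / u))) * u} := by
  have hsum := summable_one_div_nat_add_one_sq
  have hpos : 0 < ∑' n : ℕ, 1 / ((n : ℝ) + 1) ^ 2 :=
    hsum.tsum_pos (fun n ↦ by positivity) 0 (by norm_num)
  refine ⟨8 * ∑' n : ℕ, 1 / ((n : ℝ) + 1) ^ 2, by positivity, ?_⟩
  intro Ω _ P _ Q hQ a k ha hk _ _
  filter_upwards [eventually_gt_atTop 0] with t ht
  set G := {ω | ∀ u : ℝ≥0, 0 < u → (u : ℝ) ≤ k t → Q u ω ^ 2 ≤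
    2 * Real.exp 1 * (a t + 4 * Real.log (Real.log (Real.exp 1 * k t / u))) * u}
  have hG : P.real Gᶜ ≤ (8 * ∑' n : ℕ, 1 / ((n : ℝ) + 1) ^ 2) * Real.exp (-(a t) / 2) := by
    refine ENNReal.toReal_le_of_le_ofReal (by positivity)
      ((measure_mono fun ω hω ↦ ?_).trans (hQ.measure_exists_envelope_lt_le (ha t ht) (hk t ht)))
    simpa [G] using hω
  have hone : P.real Set.univ ≤ P.real G + P.real Gᶜ := by
    rw [← Set.union_compl_self G]
    exact measureReal_union_le _ _
  rw [probReal_univ] at hone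
  linarith
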